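/- All states are unnormalised and all spaces are finite-dimensional over $\mathbb{C}$. **Entanglement structures.** Given a 3-uniform hypergraph $G=(V,E)$ (multiple edges allowed) whose edges have their three vertices labelled by parties $A,B,C$, and a three-party state $|\phi\rangle\in\mathcal H_A\otimes\mathcal H_B\otimes\mathcal H_C$, let $|\phi\rangle_G=\bigotimes_{e\in E}|\phi\rangle$, regarded as a tensor whose parties are the vertices (each vertex holds the tensor product of its local spaces over all incident edges). For tensors $t\in\bigotimes_v\mathcal H_v$, $s\in\bigotimes_v\mathcal H_v'$ write $t\trianglerighteq s$ ($t$ degenerates to $s$) if there are linear maps $M_v(\varepsilon):\mathcal H_v\to\mathcal H_v'$, continuous in $\varepsilon>0$, with $\lim_{\varepsilon\to0}\big(\bigotimes_v M_v(\varepsilon)\big)t=s$. Let $|\mathrm{GHZ}_r(3)\rangle=\sum_{i=1}^r|i\rangle|i\rangle|i\rangle$ and $|\mathrm{EPR}_D\rangle_\triangle=\sum_{i,j,k=1}^D|ik\rangle_A|jk\rangle_B|ij\rangle_C$. The tensor power $|\phi\rangle^{\otimes m}$ is again regarded as a three-party state. **Lattices.** Both lattices are periodic and finite. The kagome lattice is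 taken modulo a finite-index group of translations; its edges are the upward and downward triangles, and the parties $A,B,C$ of every triangle sit on the three sublattices. The triangular lattice is taken modulo a finite-index group of translations preserving its proper 3-colouring; its edges are all upward and downward triangles, and the parties $A,B,C$ of every triangle sit on the three colour classes. **Generalized flattenings.** For a linear map $P$ from $\mathcal H_A\otimes\mathcal H_B\otimes\mathcal H_C$ to $\mathcal H_X\otimes\mathcal H_Y$ put $|\phi^{(P)}\rangle=P|\phi\rangle$ and $\mathrm{CR}(P)=\max \operatorname{rk}\big(P(|a\rangle|b\rangle|c\rangle)\big)$ over nonzero product tensors. The generalized flattenings considered here split one party: $P=\mathbb 1_{AB}\otimes P_C$ with $P_C:\mathcal H_C\to\mathcal H_{X'}\otimes\mathcal H_{Y'}$ an arbitrary linear map into finite-dimensional spaces, where $AX'$ is grouped as $X$ and $BY'$ as $Y$; likewise with the roles of $A,B,C$ permuted in any way. **Theorem.** Let $r\ge0$ and let $|\phi\rangle$ be a three-party state. 1. If $|\mathrm{GHZ}_r(3)\rangle_G\trianglerighteq|\phi\rangle_G$ for $G$ a kagome lattice, then for every such generalized flattening $P$ of $|\phi\rangle^{\otimes2}$ $$\operatorname{rk}\big((|\phi\rangle^{\otimes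 2})^{(P)}\big)\le r^2\,\mathrm{CR}(P),\qquad\text{i.e. } r^2\ge\frac{\operatorname{rk}\big((|\phi\rangle^{\otimes 2})^{(P)}\big)}{\mathrm{CR}(P)}\text{ if }P\ne0 .$$ If $|\phi\rangle=|\mathrm{EPR}_D\rangle_\triangle$, then $r^2\ge 2D^4-D^2$. 2. If $|\mathrm{GHZ}_r(3)\rangle_G\trianglerighteq|\phi\rangle_G$ for $G$ a triangular lattice, then for every such generalized flattening $P$ of $|\phi\rangle^{\otimes6}$ $$\operatorname{rk}\big((|\phi\rangle^{\otimes 6})^{(P)}\big)\le r^6\,\mathrm{CR}(P).$$ If $|\phi\rangle=|\mathrm{EPR}_D\rangle_\triangle$, then $r^6\ge 2D^{12}-D^6$. -/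

import Mathlib

open Filter Topology

noncomputable section

namespace EntStruct

/-! ## Tensors in coordinates, local maps, degeneration -/

/-- A tensor (unnormalised pure state) with set of parties `V`, the party `v` holding the
finite-dimensional space with orthonormal basis indexed by `I v`. -/
abbrev Tensor {V : Type*} (I : V → Type*) : Type _ := ((v : V) → I v) → ℂ

open Classical in
/-- `(⨂ᵥ Mᵥ) t`. -/
def applyLocal {V : Type*} [Fintype V] {I J : V → Type*} [∀ v, Fintype (I v)]
    (M : (v : V) → Matrix (J v) (I v) ℂ) (t : Tensor I) : Tensor J :=
  fun j => ∑ i : (v : V) → I v, (∏ v, M v (j v) (i v)) * t i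

/-- `t` degenerates to `s`: there are local maps `Mᵥ(ε)`, depending continuously on `ε > 0`,
with `(⨂ᵥ Mᵥ(ε)) t → s` as `ε → 0`. -/
def Degenerates {V : Type*} [Fintype V] {I J : V → Type*} [∀ v, Fintype (I v)]
    (t : Tensor I) (s : Tensor J) : Prop :=
  ∃ M : ℝ → (v : V) → Matrix (J v) (I v) ℂ,
    (∀ v, ContinuousOn (fun ε => M ε v) (Set.Ioi 0)) ∧
      Tendsto (fun ε => applyLocal (M ε) t) (𝓝[>] 0) (𝓝 s)

/-- The product tensor `⨂ᵥ ψᵥ`. -/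
def productTensor {V : Type*} [Fintype V] {I : V → Type*} (ψ : (v : V) → I v → ℂ) : Tensor I :=
  fun i => ∏ v, ψ v (i v)

/-- The `m`-th tensor power of `φ`, regarded again as a tensor with the same parties
(each party groups its `m` copies). -/
def tensorPow {V : Type*} {I : V → Type*} (m : ℕ) (φ : Tensor I) :
    Tensor (fun v => Fin m → I v) :=
  fun s => ∏ k, φ (fun v => s v k)

/-- The three-party state `∑ᵢ |i⟩|i⟩|i⟩` of level `r`. -/
def ghz (r : ℕ) : Tensor (fun _ : Fin 3 => Fin r) :=
  fun s => if s 0 = s 1 ∧ s 1 = s 2 then 1 else 0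

/-- The three-party state `∑ᵢⱼₖ |ik⟩|jk⟩|ij⟩`, all of `i, j, k` running over `D` values. -/
def eprTriangle (D : ℕ) : Tensor (fun _ : Fin 3 => Fin D × Fin D) :=
  fun s => if (s 0).1 = (s 2).1 ∧ (s 1).1 = (s 2).2 ∧ (s 0).2 = (s 1).2 then 1 else 0

/-! ## Generalized flattenings -/

/-- The commutative rank of a linear map `P` from tensors to 2-tensors (matrices): the largest
rank of the image of a nonzero product tensor. -/
def commRank {V : Type*} [Fintype V] {I : V → Type*} {X Y : Type*} [Fintype Y]
    (P : Tensor I →ₗ[ℂ] Matrix X Y ℂ) : ℕ :=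
  sSup {k | ∃ ψ : (v : V) → I v → ℂ, (∀ v, ψ v ≠ 0) ∧ (P (productTensor ψ)).rank = k}

/-- The supremum in `commRank` is over a bounded set of ranks. -/
theorem rank_le_commRank {V : Type*} [Fintype V] {I : V → Type*} {X Y : Type*} [Fintype Y]
    (P : Tensor I →ₗ[ℂ] Matrix X Y ℂ) (ψ : (v : V) → I v → ℂ) (hψ : ∀ v, ψ v ≠ 0) :
    (P (productTensor ψ)).rank ≤ commRank P := by
  refine le_csSup ⟨Fintype.card Y, ?_⟩ ⟨ψ, hψ, rfl⟩
  rintro k ⟨χ, -, rfl⟩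
  exact Matrix.rank_le_card_width _

/-- A family `(a, b, c)` indexed by the three parties. -/
def triple {K : Fin 3 → Type*} (a : K 0) (b : K 1) (c : K 2) : (p : Fin 3) → K p
  | 0 => a
  | 1 => b
  | 2 => c

/-- The generalized flattening `𝟙 ⊗ 𝟙 ⊗ P` of three-party tensors, where the party `σ 2` is split
by an arbitrary linear map `P` into `X` and `Y`; the party `σ 0` is grouped with `X` and the party
`σ 1` is grouped with `Y`. -/
def splitFlattening {I : Fin 3 → Type*} {X Y : Type*} (σ : Equiv.Perm (Fin 3))
    (P : (I (σ 2) → ℂ) →ₗ[ℂ] Matrix X Y ℂ) :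
    Tensor I →ₗ[ℂ] Matrix (I (σ 0) × X) (I (σ 1) × Y) ℂ where
  toFun t := Matrix.of fun ax bY =>
    P (fun c => t (Equiv.piCongrLeft I σ
      (triple (K := fun p => I (σ p)) ax.1 bY.1 c))) ax.2 bY.2
  map_add' s t := by
    ext ax bY
    have h : ∀ f g : I (σ 2) → ℂ, P (fun c => f c + g c) = P f + P g := fun f g => P.map_add f g
    simp [h]
  map_smul' z t := by
    ext ax bY
    have h : ∀ f : I (σ 2) → ℂ, P (fun c => z * f c) = z • P f := fun f => P.map_smul z f
    simp [h]

/-! ## Entanglement structures on 3-uniform hypergraphs -/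

/-- A 3-uniform hypergraph (multiple edges allowed) in which the three distinct vertices of each
edge are labelled by the parties `0, 1, 2` that sit there. -/
structure TriHypergraph (V E : Type*) where
  vert : E → Fin 3 → V
  vert_injective : ∀ e, Function.Injective (vert e)

namespace TriHypergraph

variable {V E : Type*}

/-- Basis index of the space `H_v`, the tensor product over all edges `e` at `v` of the local
spaces `H_{e,v}`. -/
def VertexIndex (G : TriHypergraph V E) (I : Fin 3 → Type*) (v : V) : Type _ :=
  (x : {x : E × Fin 3 // G.vert x.1 x.2 = v}) → I x.1.2

instance (G : TriHypergraph V E) (I : Fin 3 → Type*) [Fintype E] [∀ p, Fintype (I p)] (v : V) :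
    Fintype (G.VertexIndex I v) := by
  classical
  unfold VertexIndex
  infer_instance

/-- The entanglement structure: the tensor product over the edges of copies of `φ`, regrouped as
a tensor whose parties are the vertices. -/
def state (G : TriHypergraph V E) [Fintype E] {I : Fin 3 → Type*} (φ : Tensor I) :
    Tensor (G.VertexIndex I) :=
  fun s => ∏ e, φ (fun p => s (G.vert e p) ⟨(e, p), rfl⟩)

end TriHypergraph

/-! ## The periodic kagome and triangular lattices

The lattice of translations is `ℤ × ℤ` with generators `e₁ = (1,0)`, `e₂ = (0,1)`, spanning an
angle of 60 degrees; `Λ` is the group of periods. Plaquettes come in two orientations: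
`true` for upward and `false` for downward triangles. -/

/-- Positions of the sites of a kagome unit cell, doubled: site `p` of the cell `x` is at
`x + kagomeShift p / 2`. -/
def kagomeShift : Fin 3 → ℤ × ℤ
  | 0 => (0, 0)
  | 1 => (1, 0)
  | 2 => (0, 1)

/-- The kagome lattice with periods `Λ`. The vertex `(x, p)` is the point
`x + kagomeShift p / 2`, of sublattice `p`. Each cell `x` has the upward triangle
`x, x + e₁/2, x + e₂/2` and the downward triangle `x, x - e₁/2, x - e₂/2`. Party `p` of a plaquette
sits at its vertex of sublattice `p`. -/
def kagome (Λ : AddSubgroup (ℤ × ℤ)) :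
    TriHypergraph (((ℤ × ℤ) ⧸ Λ) × Fin 3) (((ℤ × ℤ) ⧸ Λ) × Bool) where
  vert e p := match e with
    | (x, true) => (x, p)
    | (x, false) => (x - (kagomeShift p : (ℤ × ℤ) ⧸ Λ), p)
  vert_injective := by
    rintro ⟨x, _ | _⟩ p q h
    · exact congrArg Prod.snd h
    · exact congrArg Prod.snd h

/-- The three-colouring `(x, y) ↦ x - y mod 3` of the triangular lattice. -/
def triColour : ℤ × ℤ →+ ZMod 3 :=
  (Int.castAddHom (ZMod 3)).comp (AddMonoidHom.fst ℤ ℤ - AddMonoidHom.snd ℤ ℤ)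

/-- The vertices of the upward plaquette `0, e₁, e₂` and of the downward plaquette
`e₁ + e₂, e₁, e₂`, listed by colour. -/
def triOffset (up : Bool) (k : ZMod 3) : ℤ × ℤ :=
  if k = 0 then (if up then (0, 0) else (1, 1)) else if k = 1 then (1, 0) else (0, 1)

theorem triColour_triOffset (up : Bool) (k : ZMod 3) : triColour (triOffset up k) = k := by
  have h : ∀ v : ℤ × ℤ, triColour v = ((v.1 - v.2 : ℤ) : ZMod 3) := fun v => by
    simp [triColour]
  rw [h]
  revert up k
  decide

/-- The triangular lattice with periods `Λ` that respect the three-colouring. The vertices are the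
points of `ℤ × ℤ` modulo `Λ`; each `x` has the upward plaquette `x, x + e₁, x + e₂` and the
downward plaquette `x + e₁ + e₂, x + e₁, x + e₂`. Party `p` of a plaquette sits at its vertex
of colour `p`. -/
def triangular (Λ : AddSubgroup (ℤ × ℤ)) (hΛ : Λ ≤ triColour.ker) :
    TriHypergraph ((ℤ × ℤ) ⧸ Λ) (((ℤ × ℤ) ⧸ Λ) × Bool) where
  vert e p := e.1 + ((triOffset e.2
    (((p : ℕ) : ZMod 3) - QuotientAddGroup.lift Λ triColour hΛ e.1) : ℤ × ℤ) : (ℤ × ℤ) ⧸ Λ)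
  vert_injective := by
    rintro ⟨x, up⟩ p q h
    have h' := congrArg (QuotientAddGroup.lift Λ triColour hΛ) h
    simp only [map_add, QuotientAddGroup.lift_mk, triColour_triOffset] at h'
    have h2 : ((p : ℕ) : ZMod 3) = ((q : ℕ) : ZMod 3) := by simpa using h'
    revert h2
    clear h h'
    revert p q
    decide

end EntStruct

end

noncomputable section

namespace EntStruct

/-! ## Ranks of matrices -/

/-! Let C be the party to be split, Q the set of C-vertices and k the number of plaquettes at each
of them (2 on the kagome lattice, 6 on the triangular one). Every plaquette has exactly one
C-vertex, so the state of the lattice is a product over Q of clusters φ^{⊗k}. Apply P at all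
C-vertices at once, with all A-vertices on the row side and all B-vertices on the column side. The
A- and B-vertices may join different clusters, but this only regroups indices within rows or within
columns. Hence the flattened lattice state is a Kronecker product, of rank rk^{|Q|}
(`latticeFlattening_state`, `rank_piKronecker`).

On the other side, the GHZ structure is a sum of r^{|E|} = r^{k|Q|} product tensors, and local maps
keep this form (`applyLocal_state_ghz`). For a product tensor the A- and B-vertices merely rescale
rows and columns, so its flattening has rank at most CR(P)^{|Q|}
(`rank_latticeFlattening_productTensor_le`). Lower semicontinuity of the rank carries the bound to
the limit, and the |Q|-th root gives the claim.

For EPR pairs, k copies of level D form a triangle of level N = D^k. Pair the split space ℂ^N ⊗ ℂ^N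
with v_κ ⊗ v_κ for 2N-1 vectors v_κ in general position, then let the resulting w in ℂ^{2N-1} act by
w ∧ · from degree N-1 to degree N. This flattening has full column rank N² C(2N-1, N-1), while
product tensors reach at most C(2N-2, N-1). The quotient is N(2N-1) = 2N² - N. -/

theorem exists_rank_factorization {m n : Type*} [Fintype m] [Fintype n] (M : Matrix m n ℂ) :
    ∃ (U : Matrix m (Fin M.rank) ℂ) (V : Matrix (Fin M.rank) n ℂ)
      (L : Matrix (Fin M.rank) m ℂ) (R : Matrix n (Fin M.rank) ℂ),
      M = U * V ∧ L * U = 1 ∧ V * R = 1 := by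
  classical
  let b : Module.Basis (Fin M.rank) ℂ (LinearMap.range M.mulVecLin) :=
    Module.finBasisOfFinrankEq ℂ _ rfl
  let u : (Fin M.rank → ℂ) →ₗ[ℂ] (m → ℂ) :=
    (LinearMap.range M.mulVecLin).subtype ∘ₗ b.equivFun.symm.toLinearMap
  let v : (n → ℂ) →ₗ[ℂ] (Fin M.rank → ℂ) := b.equivFun.toLinearMap ∘ₗ M.mulVecLin.rangeRestrict
  have hu : LinearMap.ker u = ⊥ := LinearMap.ker_eq_bot.2
    (Subtype.val_injective.comp b.equivFun.symm.injective)
  have hv : LinearMap.range v = ⊤ := LinearMap.range_eq_top.2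
    (b.equivFun.surjective.comp M.mulVecLin.surjective_rangeRestrict)
  obtain ⟨l, hl⟩ := u.exists_leftInverse_of_injective hu
  obtain ⟨r, hr⟩ := v.exists_rightInverse_of_surjective hv
  refine ⟨LinearMap.toMatrix' u, LinearMap.toMatrix' v, LinearMap.toMatrix' l,
    LinearMap.toMatrix' r, ?_, ?_, ?_⟩
  · rw [← LinearMap.toMatrix'_comp]
    have : u ∘ₗ v = Matrix.toLin' M := by
      ext x
      simp [u, v]
    rw [this, LinearMap.toMatrix'_toLin']
  · rw [← LinearMap.toMatrix'_comp, hl, LinearMap.toMatrix'_id]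
  · rw [← LinearMap.toMatrix'_comp, hr, LinearMap.toMatrix'_id]

theorem rank_add_le {m n : Type*} [Fintype m] [Fintype n] (A B : Matrix m n ℂ) :
    (A + B).rank ≤ A.rank + B.rank := by
  have h : LinearMap.range (A + B).mulVecLin ≤
      LinearMap.range A.mulVecLin ⊔ LinearMap.range B.mulVecLin := by
    rintro _ ⟨x, rfl⟩
    rw [Matrix.mulVecLin_add]
    exact Submodule.add_mem_sup ⟨x, rfl⟩ ⟨x, rfl⟩
  exact (Submodule.finrank_mono h).trans (Submodule.finrank_add_le_finrank_add_finrank _ _)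

theorem rank_sum_le {ι m n : Type*} [Fintype m] [Fintype n] (s : Finset ι)
    (A : ι → Matrix m n ℂ) : (∑ i ∈ s, A i).rank ≤ ∑ i ∈ s, (A i).rank := by
  classical
  induction s using Finset.induction_on with
  | empty => simp
  | insert a s ha ih =>
    rw [Finset.sum_insert ha, Finset.sum_insert ha]
    exact (rank_add_le _ _).trans (by gcongr)

/-- Lower semicontinuity of the rank. -/
theorem rank_le_of_tendsto {α m n : Type*} [Fintype m] [Fintype n] {l : Filter α} [l.NeBot]
    {A : α → Matrix m n ℂ} {M : Matrix m n ℂ} (h : Tendsto A l (𝓝 M)) {k : ℕ}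
    (hA : ∀ a, (A a).rank ≤ k) : M.rank ≤ k := by
  obtain ⟨U, V, L, R, hM, hL, hR⟩ := exists_rank_factorization M
  -- Compressed by `L` and `R`, the limit becomes the identity of size `M.rank`. A nonzero
  -- determinant is an open condition, so some `A a` already has at least this rank.
  have hdet : (L * M * R).det = 1 := by
    have : L * M * R = 1 := by
      calc L * M * R = L * (U * V) * R := by rw [← hM]
        _ = (L * U) * (V * R) := by simp only [Matrix.mul_assoc]
        _ = 1 := by rw [hL, hR, one_mul]
    rw [this, Matrix.det_one]
  have hc : Continuous fun A : Matrix m n ℂ => (L * A * R).det := by fun_prop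
  have ht := (hc.tendsto M).comp h
  rw [hdet] at ht
  obtain ⟨a, ha⟩ := (ht.eventually_ne one_ne_zero).exists
  have hr : (L * A a * R).rank = M.rank := by
    rw [Matrix.rank_of_det_ne_zero (A := L * A a * R) ha, Fintype.card_fin]
  rw [← hr]
  exact (Matrix.rank_mul_le_left _ _).trans ((Matrix.rank_mul_le_right _ _).trans (hA a))

/-- The Kronecker product of a family of matrices. -/
def piKronecker {Q : Type*} [Fintype Q] {m n : Q → Type*} (M : ∀ c, Matrix (m c) (n c) ℂ) :
    Matrix (∀ c, m c) (∀ c, n c) ℂ :=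
  Matrix.of fun x y => ∏ c, M c (x c) (y c)

section piKronecker

variable {Q : Type*} [Fintype Q] {l m n : Q → Type*}

theorem piKronecker_mul [DecidableEq Q] [∀ c, Fintype (m c)] (M : ∀ c, Matrix (l c) (m c) ℂ)
    (N : ∀ c, Matrix (m c) (n c) ℂ) :
    piKronecker M * piKronecker N = piKronecker fun c => M c * N c := by
  ext x y
  simp only [piKronecker, Matrix.mul_apply, Matrix.of_apply, Fintype.prod_sum,
    Finset.prod_mul_distrib]

theorem piKronecker_one [∀ c, DecidableEq (m c)] :
    piKronecker (fun c => (1 : Matrix (m c) (m c) ℂ)) = 1 := by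
  ext x y
  by_cases h : x = y
  · subst h
    simp [piKronecker]
  · obtain ⟨c, hc⟩ := Function.ne_iff.1 h
    rw [Matrix.one_apply_ne h]
    exact Finset.prod_eq_zero (Finset.mem_univ c) (Matrix.one_apply_ne hc)

/-- Kronecker products of rank factorizations are again factorizations through a space of the
product dimension, and their one-sided inverses are inherited; the former bounds the rank above, the
latter below. -/
theorem rank_piKronecker [DecidableEq Q] [∀ c, Fintype (m c)] [∀ c, Fintype (n c)]
    (M : ∀ c, Matrix (m c) (n c) ℂ) : (piKronecker M).rank = ∏ c, (M c).rank := by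
  choose U V L R hM hL hR using fun c => exists_rank_factorization (M c)
  have hcard : Fintype.card (∀ c, Fin (M c).rank) = ∏ c, (M c).rank := by simp
  have hUV : piKronecker M = piKronecker U * piKronecker V := by
    rw [piKronecker_mul]
    exact congrArg piKronecker (funext hM)
  apply le_antisymm
  · rw [hUV, ← hcard]
    exact (Matrix.rank_mul_le_left _ _).trans (Matrix.rank_le_card_width _)
  · have h1 : piKronecker L * piKronecker M * piKronecker R = 1 := by
      rw [hUV, ← Matrix.mul_assoc, piKronecker_mul, Matrix.mul_assoc, piKronecker_mul,
        funext hL, funext hR, piKronecker_one, one_mul]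
    rw [← hcard, ← Matrix.rank_one (R := ℂ), ← h1]
    exact (Matrix.rank_mul_le_left _ _).trans (Matrix.rank_mul_le_right _ _)

end piKronecker

/-- Tensoring a matrix with a matrix `α βᵀ` of rank at most one does not increase the rank. -/
theorem rank_tensor_le {a b m n : Type*} [Fintype a] [Fintype b] [Fintype m] [Fintype n]
    (α : a → ℂ) (β : b → ℂ) (M : Matrix m n ℂ) :
    (Matrix.of fun (x : a × m) (y : b × n) => α x.1 * β y.1 * M x.2 y.2).rank ≤ M.rank := by
  classical
  have h : (Matrix.of fun (x : a × m) (y : b × n) => α x.1 * β y.1 * M x.2 y.2) =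
      (Matrix.of fun (x : a × m) i => if i = x.2 then α x.1 else 0) * M *
        (Matrix.of fun j (y : b × n) => if j = y.2 then β y.1 else 0) := by
    ext x y
    simp [Matrix.mul_apply]
    ring
  rw [h]
  exact (Matrix.rank_mul_le_left _ _).trans (Matrix.rank_mul_le_right _ _)

/-! ## Splitting one party of every plaquette -/

theorem piCongrLeft_triple_map {I J : Fin 3 → Type*} (σ : Equiv.Perm (Fin 3))
    (F : ∀ p, I p → J p) (a : I (σ 0)) (b : I (σ 1)) (c : I (σ 2)) (p : Fin 3) :
    F p (Equiv.piCongrLeft I σ (triple (K := fun p => I (σ p)) a b c) p) =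
      Equiv.piCongrLeft J σ (triple (K := fun p => J (σ p)) (F _ a) (F _ b) (F _ c)) p := by
  obtain ⟨i, rfl⟩ := σ.surjective p
  rw [Equiv.piCongrLeft_apply_apply, Equiv.piCongrLeft_apply_apply]
  fin_cases i <;> rfl

theorem piCongrLeft_triple_apply {I : Fin 3 → Type*} (σ : Equiv.Perm (Fin 3))
    (a : I (σ 0)) (b : I (σ 1)) (c : I (σ 2)) :
    Equiv.piCongrLeft I σ (triple (K := fun p => I (σ p)) a b c) (σ 0) = a ∧
    Equiv.piCongrLeft I σ (triple (K := fun p => I (σ p)) a b c) (σ 1) = b ∧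
    Equiv.piCongrLeft I σ (triple (K := fun p => I (σ p)) a b c) (σ 2) = c :=
  ⟨Equiv.piCongrLeft_apply_apply _ _ _ _, Equiv.piCongrLeft_apply_apply _ _ _ _,
    Equiv.piCongrLeft_apply_apply _ _ _ _⟩

theorem prod_perm_three {M : Type*} [CommMonoid M] (σ : Equiv.Perm (Fin 3)) (f : Fin 3 → M) :
    ∏ p, f p = f (σ 0) * f (σ 1) * f (σ 2) := by
  rw [← Equiv.prod_comp σ, Fin.prod_univ_three]

theorem splitFlattening_productTensor {I : Fin 3 → Type*} {X Y : Type*}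
    (σ : Equiv.Perm (Fin 3)) (P : (I (σ 2) → ℂ) →ₗ[ℂ] Matrix X Y ℂ)
    (ψ : ∀ p, I p → ℂ) :
    splitFlattening σ P (productTensor ψ) = Matrix.of fun x y =>
      ψ (σ 0) x.1 * ψ (σ 1) y.1 * P (ψ (σ 2)) x.2 y.2 := by
  ext x y
  have h : (fun c => productTensor ψ (Equiv.piCongrLeft I σ
      (triple (K := fun p => I (σ p)) x.1 y.1 c))) =
      (ψ (σ 0) x.1 * ψ (σ 1) y.1) • ψ (σ 2) := by
    ext c
    obtain ⟨h0, h1, h2⟩ := piCongrLeft_triple_apply (I := I) σ x.1 y.1 c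
    rw [productTensor, prod_perm_three σ, h0, h1, h2]
    rfl
  simp only [splitFlattening, LinearMap.coe_mk, AddHom.coe_mk, Matrix.of_apply, h, map_smul]
  rfl

/-- The commutative rank of a splitting bounds the rank of the image of every vector of the
party that is split. -/
theorem rank_le_commRank_splitFlattening {I : Fin 3 → Type*} [∀ p, Fintype (I p)] {X Y : Type*}
    [Fintype X] [Fintype Y] (σ : Equiv.Perm (Fin 3)) (P : (I (σ 2) → ℂ) →ₗ[ℂ] Matrix X Y ℂ)
    (f : I (σ 2) → ℂ) :
    (Matrix.of fun (x : I (σ 0) × X) (y : I (σ 1) × Y) => P f x.2 y.2).rank ≤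
      commRank (splitFlattening σ P) := by
  by_cases hf : f = 0
  · subst hf
    have : (Matrix.of fun (x : I (σ 0) × X) (y : I (σ 1) × Y) => P 0 x.2 y.2) = 0 := by
      ext x y
      simp
    rw [this, Matrix.rank_zero]
    exact Nat.zero_le _
  -- `commRank` only tests nonzero vectors. The vector `f` is completed by all-ones vectors, which
  -- are nonzero only over nonempty index types; otherwise the matrix has no rows or no columns.
  rcases isEmpty_or_nonempty (I (σ 0)) with h0 | ⟨⟨a⟩⟩
  · refine (Matrix.rank_le_card_height _).trans ?_
    simp
  rcases isEmpty_or_nonempty (I (σ 1)) with h1 | ⟨⟨b⟩⟩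
  · refine (Matrix.rank_le_card_width _).trans ?_
    simp
  let ψ : ∀ p, I p → ℂ := Equiv.piCongrLeft (fun p => I p → ℂ) σ
    (triple (K := fun p => I (σ p) → ℂ) (fun _ => 1) (fun _ => 1) f)
  obtain ⟨h0, h1, h2⟩ := piCongrLeft_triple_apply (I := fun p => I p → ℂ) σ
    (fun _ => 1) (fun _ => 1) f
  have hψ : ∀ p, ψ p ≠ 0 := by
    intro p
    obtain ⟨i, rfl⟩ := σ.surjective p
    fin_cases i
    · exact h0.trans_ne fun h => one_ne_zero (congrFun h a)
    · exact h1.trans_ne fun h => one_ne_zero (congrFun h b)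
    · exact h2.trans_ne hf
  have h := rank_le_commRank (splitFlattening σ P) ψ hψ
  rw [splitFlattening_productTensor] at h
  simpa only [ψ, h0, h1, h2, one_mul] using h

/-! ### Flattening a whole entanglement structure -/

namespace TriHypergraph

variable {V E : Type*} (G : TriHypergraph V E) {I : Fin 3 → Type*}

/-- The basis index of the entanglement structure in which party `p` of the edge `e` is in the
state `θ p e`. -/
def assignment (θ : ∀ p, E → I p) (v : V) : G.VertexIndex I v :=
  fun x => θ x.1.2 x.1.1

/-- The entanglement structure of GHZ states is a sum of product tensors, and so is every tensor
obtained from it by local maps. -/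
theorem applyLocal_state_ghz [Fintype V] [Fintype E] [DecidableEq E] {J : V → Type*} (r : ℕ)
    (M : ∀ v, Matrix (J v) (G.VertexIndex (fun _ => Fin r) v) ℂ) :
    applyLocal M (G.state (ghz r)) =
      ∑ i : E → Fin r, productTensor fun v j => M v j (G.assignment (fun _ => i) v) := by
  classical
  -- The coefficient is 1 exactly when the three indices on each edge agree, that is, when the basis
  -- index comes from a labelling of the edges by levels.
  have hstate : ∀ s, G.state (ghz r) s =
      ∑ i : E → Fin r, if s = G.assignment (fun _ => i) then (1 : ℂ) else 0 := by
    intro s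
    by_cases h : ∃ i : E → Fin r, s = G.assignment (fun _ => i)
    · obtain ⟨i, rfl⟩ := h
      have hinj : ∀ i' : E → Fin r,
          (G.assignment (fun _ => i) = G.assignment (fun _ => i')) ↔ i = i' := by
        refine fun i' => ⟨fun h => funext fun e => ?_, fun h => h ▸ rfl⟩
        exact congrFun (congrFun h (G.vert e 0)) ⟨(e, 0), rfl⟩
      simp only [hinj, Finset.sum_ite_eq, Finset.mem_univ, if_true]
      exact Finset.prod_eq_one fun e _ => if_pos ⟨rfl, rfl⟩
    · rw [Finset.sum_eq_zero fun i _ => if_neg fun hi => h ⟨i, hi⟩]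
      by_contra hne
      refine h ⟨fun e => s (G.vert e 0) ⟨(e, 0), rfl⟩, ?_⟩
      have he : ∀ e, s (G.vert e 0) ⟨(e, 0), rfl⟩ = s (G.vert e 1) ⟨(e, 1), rfl⟩ ∧
          s (G.vert e 1) ⟨(e, 1), rfl⟩ = s (G.vert e 2) ⟨(e, 2), rfl⟩ := by
        intro e
        by_contra h0
        exact hne (Finset.prod_eq_zero (Finset.mem_univ e) (if_neg h0))
      funext v ⟨⟨e, p⟩, hx⟩
      subst hx
      change _ = s (G.vert e 0) ⟨(e, 0), rfl⟩
      fin_cases p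
      · rfl
      · exact (he e).1.symm
      · exact ((he e).1.trans (he e).2).symm
  funext j
  simp only [applyLocal, hstate, Finset.mul_sum, Finset.sum_apply, mul_ite, mul_one, mul_zero]
  rw [Finset.sum_comm]
  refine Finset.sum_congr rfl fun i _ => ?_
  rw [Finset.sum_ite_eq', if_pos (Finset.mem_univ _)]
  rfl

variable {Q : Type*} {k : ℕ} {X Y : Type*}

/-- The basis index of the entanglement structure assembled from one three-party basis index for
the `k` edges at each of the vertices in `Q`. -/
def clusterAssignment (ε : Q × Fin k ≃ E) (σ : Equiv.Perm (Fin 3)) (a : Q → Fin k → I (σ 0))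
    (b : Q → Fin k → I (σ 1)) (c : Q → Fin k → I (σ 2)) : ∀ p, E → I p :=
  Equiv.piCongrLeft (fun p => E → I p) σ (triple (K := fun p => E → I (σ p))
    (fun e => a (ε.symm e).1 (ε.symm e).2) (fun e => b (ε.symm e).1 (ε.symm e).2)
    (fun e => c (ε.symm e).1 (ε.symm e).2))

/-- The flattening that splits all vertices in `Q` by the map `P`. -/
def latticeFlattening [Fintype Q] [∀ p, Fintype (I p)] (ε : Q × Fin k ≃ E)
    (σ : Equiv.Perm (Fin 3)) (P : ((Fin k → I (σ 2)) → ℂ) →ₗ[ℂ] Matrix X Y ℂ)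
    (t : Tensor (G.VertexIndex I)) :
    Matrix (Q → (Fin k → I (σ 0)) × X) (Q → (Fin k → I (σ 1)) × Y) ℂ :=
  open Classical in
  Matrix.of fun x y => ∑ γ : Q → Fin k → I (σ 2),
    (∏ c, P (Pi.single (γ c) 1) (x c).2 (y c).2) *
      t (G.assignment (clusterAssignment ε σ (fun c => (x c).1) (fun c => (y c).1) γ))

theorem apply_eq_sum_single {ι : Type*} [Fintype ι] [DecidableEq ι]
    (P : (ι → ℂ) →ₗ[ℂ] Matrix X Y ℂ) (f : ι → ℂ) (x : X) (y : Y) :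
    P f x y = ∑ i, P (Pi.single i 1) x y * f i := by
  conv_lhs => rw [← Finset.univ_sum_single f]
  rw [map_sum, Matrix.sum_apply]
  refine Finset.sum_congr rfl fun i _ => ?_
  have : (Pi.single i (f i) : ι → ℂ) = f i • Pi.single i 1 := by
    rw [← Pi.single_smul, smul_eq_mul, mul_one]
  rw [this, map_smul, Matrix.smul_apply, smul_eq_mul, mul_comm]

/-- Reindexing the edges by `ε` collects the factors `φ` into one cluster per vertex of `Q`; the sum
over the split indices then distributes over the clusters. -/
theorem latticeFlattening_state [Fintype E] [Fintype Q] [∀ p, Fintype (I p)]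
    (ε : Q × Fin k ≃ E) (σ : Equiv.Perm (Fin 3))
    (P : ((Fin k → I (σ 2)) → ℂ) →ₗ[ℂ] Matrix X Y ℂ) (φ : Tensor I) :
    G.latticeFlattening ε σ P (G.state φ) = piKronecker fun _ : Q =>
      splitFlattening (I := fun p => Fin k → I p) σ P (tensorPow k φ) := by
  classical
  ext x y
  simp only [latticeFlattening, piKronecker, Matrix.of_apply, splitFlattening, LinearMap.coe_mk,
    AddHom.coe_mk]
  simp_rw [apply_eq_sum_single P (fun c => tensorPow k φ _), Fintype.prod_sum,
    Finset.prod_mul_distrib]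
  refine Finset.sum_congr (by congr!) fun γ _ => ?_
  congr 1
  change ∏ e, φ (fun p => clusterAssignment ε σ _ _ γ p e) = _
  rw [← Equiv.prod_comp ε, Fintype.prod_prod_type]
  refine Finset.prod_congr rfl fun c _ => Finset.prod_congr rfl fun m _ => ?_
  congr 1
  funext p
  have h := piCongrLeft_triple_map (I := fun p => E → I p) (J := fun p => Fin k → I p) σ
    (fun p f m => f (ε (c, m))) (fun e => (x (ε.symm e).1).1 (ε.symm e).2)
    (fun e => (y (ε.symm e).1).1 (ε.symm e).2) (fun e => γ (ε.symm e).1 (ε.symm e).2) p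
  simp only [Equiv.symm_apply_apply] at h
  exact congrFun h m

theorem latticeFlattening_sum [Fintype Q] [∀ p, Fintype (I p)] (ε : Q × Fin k ≃ E)
    (σ : Equiv.Perm (Fin 3)) (P : ((Fin k → I (σ 2)) → ℂ) →ₗ[ℂ] Matrix X Y ℂ) {ι : Type*}
    (s : Finset ι) (t : ι → Tensor (G.VertexIndex I)) :
    G.latticeFlattening ε σ P (∑ i ∈ s, t i) = ∑ i ∈ s, G.latticeFlattening ε σ P (t i) := by
  ext x y
  simp only [latticeFlattening, Matrix.of_apply, Matrix.sum_apply, Finset.sum_apply,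
    Finset.mul_sum]
  rw [Finset.sum_comm]

theorem continuous_latticeFlattening [Fintype Q] [∀ p, Fintype (I p)] (ε : Q × Fin k ≃ E)
    (σ : Equiv.Perm (Fin 3)) (P : ((Fin k → I (σ 2)) → ℂ) →ₗ[ℂ] Matrix X Y ℂ) :
    Continuous (G.latticeFlattening ε σ P) := by
  refine continuous_matrix fun x y => ?_
  simp only [latticeFlattening, Matrix.of_apply]
  fun_prop

/-- The basis index at a vertex that only plays the role of party `p`. -/
def partyIndex {col : V → Fin 3} (hcol : ∀ e p, col (G.vert e p) = p) {p : Fin 3}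
    (v : {v // col v = p}) (f : E → I p) : G.VertexIndex I v :=
  fun x => cast (congrArg I ((hcol x.1.1 x.1.2).symm.trans ((congrArg col x.2).trans v.2)).symm)
    (f x.1.1)

theorem assignment_eq_partyIndex {col : V → Fin 3} (hcol : ∀ e p, col (G.vert e p) = p)
    {p : Fin 3} (v : {v // col v = p}) (θ : ∀ p, E → I p) :
    G.assignment θ v = G.partyIndex hcol v (θ p) := by
  funext ⟨⟨e, p'⟩, hx⟩
  have h : p' = p := (hcol e p').symm.trans ((congrArg col hx).trans v.2)
  subst h
  rfl

/-- A vertex sees only its own edges. This makes the factor at a split vertex depend on its own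
cluster alone. -/
theorem partyIndex_congr {col : V → Fin 3} (hcol : ∀ e p, col (G.vert e p) = p)
    {p : Fin 3} (v : {v // col v = p}) {f g : E → I p} (h : ∀ e, G.vert e p = v → f e = g e) :
    G.partyIndex hcol v f = G.partyIndex hcol v g := by
  funext ⟨⟨e, p'⟩, hx⟩
  have hp : p' = p := (hcol e p').symm.trans ((congrArg col hx).trans v.2)
  subst hp
  exact h e hx

/-- The flattening of a product tensor has rank at most `commRank ^ |Q|`. -/
theorem rank_latticeFlattening_productTensor_le [Fintype V] [DecidableEq V] [Fintype E]
    {col : V → Fin 3}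
    (hcol : ∀ e p, col (G.vert e p) = p) [∀ p, Fintype (I p)] [Fintype X] [Fintype Y]
    (σ : Equiv.Perm (Fin 3)) (ε : {v // col v = σ 2} × Fin k ≃ E)
    (hε : ∀ c m, G.vert (ε (c, m)) (σ 2) = c)
    (P : ((Fin k → I (σ 2)) → ℂ) →ₗ[ℂ] Matrix X Y ℂ) (ψ : ∀ v, G.VertexIndex I v → ℂ) :
    (G.latticeFlattening ε σ P (productTensor ψ)).rank ≤
      commRank (splitFlattening (I := fun p => Fin k → I p) σ P) ^
        Fintype.card {v // col v = σ 2} := by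
  classical
  let Ψ (p : Fin 3) (f : E → I p) : ℂ := ∏ v : {v // col v = p}, ψ v (G.partyIndex hcol v f)
  have hΨ : ∀ θ : ∀ p, E → I p, productTensor ψ (G.assignment θ) =
      Ψ (σ 0) (θ (σ 0)) * Ψ (σ 1) (θ (σ 1)) * Ψ (σ 2) (θ (σ 2)) := by
    intro θ
    rw [← prod_perm_three σ (fun p => Ψ p (θ p)), productTensor,
      ← Fintype.prod_fiberwise col]
    refine Finset.prod_congr rfl fun p _ => Finset.prod_congr rfl fun v _ => ?_
    rw [assignment_eq_partyIndex G hcol]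
  -- Only the values of `g` on the `k` edges at `c` matter; repeating `g` in every cluster is a
  -- convenient extension to all edges.
  let N (c : {v // col v = σ 2}) (g : Fin k → I (σ 2)) : ℂ :=
    ψ c (G.partyIndex hcol c fun e => g (ε.symm e).2)
  have hN : ∀ γ : {v // col v = σ 2} → Fin k → I (σ 2),
      Ψ (σ 2) (fun e => γ (ε.symm e).1 (ε.symm e).2) = ∏ c, N c (γ c) := by
    intro γ
    refine Finset.prod_congr rfl fun v _ => ?_
    congr 1
    refine G.partyIndex_congr hcol v fun e he => ?_
    have h1 := hε (ε.symm e).1 (ε.symm e).2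
    rw [Prod.mk.eta, Equiv.apply_symm_apply, he] at h1
    rw [Subtype.ext h1]
  -- The factors from the two unsplit parties depend on the row alone or on the column alone, hence
  -- the diagonal matrices.
  have hM : G.latticeFlattening ε σ P (productTensor ψ) =
      Matrix.diagonal (fun x : {v // col v = σ 2} → (Fin k → I (σ 0)) × X =>
        Ψ (σ 0) fun e => (x (ε.symm e).1).1 (ε.symm e).2) *
      (piKronecker fun c => Matrix.of fun (x : (Fin k → I (σ 0)) × X)
        (y : (Fin k → I (σ 1)) × Y) => P (N c) x.2 y.2) *
      Matrix.diagonal (fun y : {v // col v = σ 2} → (Fin k → I (σ 1)) × Y =>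
        Ψ (σ 1) fun e => (y (ε.symm e).1).1 (ε.symm e).2) := by
    ext x y
    rw [Matrix.mul_diagonal, Matrix.diagonal_mul]
    simp only [latticeFlattening, piKronecker, Matrix.of_apply]
    simp_rw [apply_eq_sum_single P (N _), Fintype.prod_sum, Finset.prod_mul_distrib,
      Finset.mul_sum, Finset.sum_mul]
    refine Finset.sum_congr (by congr!) fun γ _ => ?_
    obtain ⟨h0, h1, h2⟩ := piCongrLeft_triple_apply (I := fun p => E → I p) σ
      (fun e => (x (ε.symm e).1).1 (ε.symm e).2) (fun e => (y (ε.symm e).1).1 (ε.symm e).2)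
      (fun e => γ (ε.symm e).1 (ε.symm e).2)
    rw [hΨ, clusterAssignment, h0, h1, h2, hN]
    ring
  rw [hM]
  refine (Matrix.rank_mul_le_left _ _).trans ((Matrix.rank_mul_le_right _ _).trans ?_)
  rw [rank_piKronecker, ← Finset.card_univ]
  exact Finset.prod_le_pow_card _ _ _ fun c _ =>
    rank_le_commRank_splitFlattening (I := fun p => Fin k → I p) σ P (N c)

/-- Suppose that every vertex plays the role of only one party, and that the vertices of party
`σ 2` have degree `k`. If the GHZ states of level `r` on `G` degenerate to copies of `φ`, then all
flattenings of `φ^{⊗ k}` that split the party `σ 2` have rank at most `r ^ k * commRank`. -/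
theorem rank_splitFlattening_le_of_degenerates [Fintype V] [DecidableEq V] [Fintype E]
    {col : V → Fin 3}
    (hcol : ∀ e p, col (G.vert e p) = p) [∀ p, Fintype (I p)] [Fintype X] [Fintype Y]
    (σ : Equiv.Perm (Fin 3)) [Nonempty {v // col v = σ 2}]
    (hdeg : ∀ v, col v = σ 2 → Nat.card {e // G.vert e (σ 2) = v} = k)
    (P : ((Fin k → I (σ 2)) → ℂ) →ₗ[ℂ] Matrix X Y ℂ) {r : ℕ} {φ : Tensor I}
    (h : Degenerates (G.state (ghz r)) (G.state φ)) :
    (splitFlattening (I := fun p => Fin k → I p) σ P (tensorPow k φ)).rank ≤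
      r ^ k * commRank (splitFlattening (I := fun p => Fin k → I p) σ P) := by
  classical
  let vq (e : E) : {v // col v = σ 2} := ⟨G.vert e (σ 2), hcol e _⟩
  have hfib : ∀ c, Nonempty (Fin k ≃ {e // vq e = c}) := fun c => by
    refine ⟨(Finite.equivFinOfCardEq ?_).symm⟩
    rw [← hdeg c c.2]
    exact Nat.card_congr (Equiv.subtypeEquivRight fun e => Subtype.ext_iff)
  -- Each edge has exactly one vertex of party `σ 2`, and each such vertex has `k` edges; the
  -- numbering within a cluster is arbitrary.
  let ε : {v // col v = σ 2} × Fin k ≃ E :=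
    ((Equiv.sigmaEquivProd _ _).symm.trans (Equiv.sigmaCongrRight fun c => (hfib c).some)).trans
      (Equiv.sigmaFiberEquiv vq)
  have hε : ∀ c m, G.vert (ε (c, m)) (σ 2) = c :=
    fun c m => congrArg Subtype.val ((hfib c).some m).2
  obtain ⟨M, -, hM⟩ := h
  have hlim := ((G.continuous_latticeFlattening ε σ P).tendsto _).comp hM
  have hrank := rank_le_of_tendsto hlim fun a => by
    rw [Function.comp_apply, applyLocal_state_ghz, latticeFlattening_sum]
    exact (rank_sum_le _ _).trans (Finset.sum_le_card_nsmul _ _ _ fun i _ =>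
      G.rank_latticeFlattening_productTensor_le hcol σ ε hε P _)
  -- Since |E| = k|Q|, both sides become |Q|-th powers; the root can be taken because Q is nonempty.
  rw [latticeFlattening_state, rank_piKronecker, Finset.prod_const, Finset.card_univ,
    Finset.card_univ, Fintype.card_fun, ← Fintype.card_congr ε, Fintype.card_prod,
    Fintype.card_fin, Fintype.card_fin, smul_eq_mul, mul_comm (Fintype.card _) k, pow_mul,
    ← mul_pow] at hrank
  exact (Nat.pow_le_pow_iff_left Fintype.card_ne_zero).1 hrank

end TriHypergraph

/-! ## Exterior multiplication in coordinates -/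

section Wedge

variable {K : Type*} [LinearOrder K]

/-- The coefficient of `e_T` in `e_k ∧ e_S`. -/
def wedgeSign (k : K) (T S : Finset K) : ℂ :=
  if k ∉ S ∧ insert k S = T then (-1) ^ (S.filter (· < k)).card else 0

/-- Anticommutativity of `e_b` and `e_k`: inserting the smaller index first raises by one the
exponent of the sign of the larger. The guards drop the terms in which the first insertion gives
zero. -/
theorem wedgeSign_mul_wedgeSign (b k : K) (T R : Finset K) :
    (if b ∈ R then 0 else wedgeSign b (insert b R) R * wedgeSign k T (insert b R)) =
      -(if k ∈ R then 0 else wedgeSign k (insert k R) R * wedgeSign b T (insert k R)) := by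
  by_cases hb : b ∈ R
  · by_cases hk : k ∈ R <;> simp [wedgeSign, hb, hk]
  by_cases hk : k ∈ R
  · simp [wedgeSign, hb, hk]
  by_cases hbk : b = k
  · subst hbk
    simp [wedgeSign, hb]
  by_cases hT : insert k (insert b R) = T
  · have hT' : insert b (insert k R) = T := by rw [Finset.insert_comm, hT]
    have hkb : ¬ k = b := fun h => hbk h.symm
    rcases lt_or_gt_of_ne hbk with h | h
    · simp [wedgeSign, hb, hk, hbk, hkb, hT, hT', Finset.filter_insert, h, h.not_gt, pow_succ,
        mul_comm]
    · simp [wedgeSign, hb, hk, hbk, hkb, hT, hT', Finset.filter_insert, h, h.not_gt, pow_succ,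
        mul_comm]
  · have hT' : ¬ insert b (insert k R) = T := by rwa [Finset.insert_comm]
    simp [wedgeSign, hb, hk, hT, hT']

variable [Fintype K]

/-- The coordinates of `w ∧ e_S` in degree `q`. -/
def wedgeColumn (q : ℕ) (w : K → ℂ) (S : Finset K) : {T : Finset K // T.card = q} → ℂ :=
  fun T => ∑ k, wedgeSign k T S * w k

/-- Exterior multiplication by `w`, from degree `p` to degree `p + 1`. -/
def wedge (p : ℕ) : (K → ℂ) →ₗ[ℂ]
    Matrix {T : Finset K // T.card = p + 1} {S : Finset K // S.card = p} ℂ where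
  toFun w := Matrix.of fun T S => wedgeColumn (p + 1) w S T
  map_add' v w := by
    ext T S
    simp [wedgeColumn, mul_add, Finset.sum_add_distrib]
  map_smul' z w := by
    ext T S
    simp [wedgeColumn, Finset.mul_sum, mul_left_comm]

/-- `w ∧ w ∧ e_R = 0`. -/
theorem wedgeColumn_wedge (q : ℕ) (w : K → ℂ) (R : Finset K) :
    ∑ b ∈ Finset.univ.filter (· ∉ R), (wedgeSign b (insert b R) R * w b) •
      wedgeColumn q w (insert b R) = 0 := by
  funext T
  rw [Finset.sum_apply, Finset.sum_filter, Pi.zero_apply]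
  have h : ∀ b, (if b ∉ R then ((wedgeSign b (insert b R) R * w b) •
      wedgeColumn q w (insert b R)) T else 0) = ∑ k, (if b ∈ R then 0 else
        wedgeSign b (insert b R) R * wedgeSign k T (insert b R)) * (w b * w k) := by
    intro b
    by_cases hb : b ∈ R
    · simp [hb]
    · simp only [hb, not_false_eq_true, if_true, if_false, Pi.smul_apply, smul_eq_mul,
        wedgeColumn, Finset.mul_sum]
      exact Finset.sum_congr rfl fun k _ => by ring
  rw [Finset.sum_congr rfl fun b _ => h b]
  -- Exchanging the two summation indices changes the sign of every term, so the double sum equals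
  -- its own negative.
  rw [← self_eq_neg]
  conv_lhs => rw [Finset.sum_comm]
  rw [← Finset.sum_neg_distrib]
  refine Finset.sum_congr rfl fun k _ => ?_
  rw [← Finset.sum_neg_distrib]
  refine Finset.sum_congr rfl fun b _ => ?_
  rw [wedgeSign_mul_wedgeSign]
  ring

/-- If `w a ≠ 0`, the columns `w ∧ e_S` with `a ∉ S` already span all columns, and there are `(|K| -
1).choose p` such sets. -/
theorem rank_wedge_le (p : ℕ) (w : K → ℂ) :
    (wedge p w).rank ≤ (Fintype.card K - 1).choose p := by
  by_cases hw : w = 0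
  · rw [hw, map_zero, Matrix.rank_zero]
    exact Nat.zero_le _
  obtain ⟨a, ha⟩ := Function.ne_iff.1 hw
  let A := (Finset.univ.erase a).powersetCard p
  have hA : A.card = (Fintype.card K - 1).choose p := by
    rw [Finset.card_powersetCard, Finset.card_erase_of_mem (Finset.mem_univ a), Finset.card_univ]
  have hmem : ∀ S : Finset K, S ∈ A ↔ a ∉ S ∧ S.card = p := fun S => by
    rw [Finset.mem_powersetCard, Finset.subset_erase]
    simp
  rw [Matrix.rank_eq_finrank_span_cols, ← hA, ← Fintype.card_coe]
  refine (Submodule.finrank_mono ?_).trans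
    (finrank_range_le_card (R := ℂ) fun S : A => wedgeColumn (p + 1) w S.1)
  rw [Submodule.span_le]
  rintro _ ⟨⟨S, hS⟩, rfl⟩
  change wedgeColumn (p + 1) w S ∈ _
  by_cases haS : a ∈ S
  · have h := wedgeColumn_wedge (p + 1) w (S.erase a)
    rw [← Finset.add_sum_erase _ _ (Finset.mem_filter.2 ⟨Finset.mem_univ a,
      Finset.notMem_erase a S⟩), Finset.insert_erase haS] at h
    have hne : wedgeSign a S (S.erase a) * w a ≠ 0 := by
      refine mul_ne_zero ?_ ha
      simp [wedgeSign, Finset.insert_erase haS]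
    rw [SetLike.mem_coe, ← Submodule.smul_mem_iff _ hne, eq_neg_of_add_eq_zero_left h]
    refine Submodule.neg_mem _ (Submodule.sum_mem _ fun b hb => Submodule.smul_mem _ _
      (Submodule.subset_span ⟨⟨_, (hmem _).2 ⟨?_, ?_⟩⟩, rfl⟩))
    · simp only [Finset.mem_erase, Finset.mem_filter] at hb
      simp [Ne.symm hb.1]
    · have hb' := (Finset.mem_filter.1 (Finset.mem_erase.1 hb).2).2
      rw [Finset.card_insert_of_notMem hb', Finset.card_erase_add_one haS, hS]
  · exact Submodule.subset_span ⟨⟨S, (hmem S).2 ⟨haS, hS⟩⟩, rfl⟩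

end Wedge

/-- There are arbitrarily many vectors in `ℂ^N` in general position. -/
theorem exists_generalPosition (K N : Type*) [Fintype K] [Fintype N] :
    ∃ v : K → N → ℂ, ∀ T : Finset K, T.card = Fintype.card N →
      (∀ c : K → ℂ, (∀ i, ∑ κ ∈ T, c κ * v κ i = 0) → ∀ κ ∈ T, c κ = 0) ∧
      (∀ g : N → ℂ, (∀ κ ∈ T, ∑ i, v κ i * g i = 0) → g = 0) := by
  classical
  -- Points of the moment curve at distinct nodes: any `|N|` of them form an invertible Vandermonde
  -- matrix.
  let x : K → ℂ := fun κ => ((Fintype.equivFin K κ : ℕ) : ℂ)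
  have hx : Function.Injective x := fun κ κ' h =>
    (Fintype.equivFin K).injective (Fin.ext (Nat.cast_injective h))
  refine ⟨fun κ i => x κ ^ (Fintype.equivFin N i : ℕ), fun T hT => ?_⟩
  let τ : N ≃ T := (Fintype.equivFin N).trans (T.equivFinOfCardEq hT).symm
  let A : Matrix N N ℂ := Matrix.of fun j i => x (τ j) ^ (Fintype.equivFin N i : ℕ)
  have hA : A.det ≠ 0 := by
    have : A = (Matrix.vandermonde fun l => x (τ ((Fintype.equivFin N).symm l))).submatrix
        (Fintype.equivFin N) (Fintype.equivFin N) := by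
      ext j i
      simp [A, Matrix.vandermonde]
    rw [this, Matrix.det_submatrix_equiv_self, Matrix.det_vandermonde_ne_zero_iff]
    exact hx.comp (Subtype.val_injective.comp
      (τ.injective.comp (Fintype.equivFin N).symm.injective))
  constructor
  · intro c hc κ hκ
    have h : Matrix.vecMul (fun j => c (τ j)) A = 0 := by
      ext i
      rw [Pi.zero_apply, ← hc i, ← Finset.sum_coe_sort T, ← Equiv.sum_comp τ]
      rfl
    have := congrFun (Matrix.eq_zero_of_vecMul_eq_zero hA h) (τ.symm ⟨κ, hκ⟩)
    simpa using this
  · intro g hg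
    refine Matrix.eq_zero_of_mulVec_eq_zero hA ?_
    ext j
    exact hg _ (τ j).2

/-! ## A flattening of EPR pairs on a triangle -/

section EPR

variable {D k : ℕ} {K : Type*} [Fintype K] [LinearOrder K]

/-- The Koszul flattening along the quadratic forms `x ↦ v κ x * v κ x`. -/
def koszul (p : ℕ) (v : K → (Fin k → Fin D) → ℂ) :
    ((Fin k → Fin D × Fin D) → ℂ) →ₗ[ℂ]
      Matrix {T : Finset K // T.card = p + 1} {S : Finset K // S.card = p} ℂ :=
  wedge p ∘ₗ Matrix.mulVecLin
    (Matrix.of fun κ c => v κ (fun m => (c m).1) * v κ (fun m => (c m).2))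

/-- Once `a` and `b` agree on their shared index, `c` is forced, so the sum over `c` in a flattening
collapses to one term. -/
theorem tensorPow_eprTriangle (a b c : Fin k → Fin D × Fin D) :
    tensorPow k (eprTriangle D) (triple (K := fun _ => Fin k → Fin D × Fin D) a b c) =
      if (fun m => (a m).2) = (fun m => (b m).2) then
        if c = (fun m => ((a m).1, (b m).1)) then 1 else 0 else 0 := by
  have h : tensorPow k (eprTriangle D) (triple (K := fun _ => Fin k → Fin D × Fin D) a b c) =
      ∏ m, if (a m).1 = (c m).1 ∧ (b m).1 = (c m).2 ∧ (a m).2 = (b m).2 then (1 : ℂ) else 0 := rfl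
  rw [h, Finset.prod_boole, ← ite_and]
  have key : (∀ m ∈ Finset.univ, (a m).1 = (c m).1 ∧ (b m).1 = (c m).2 ∧ (a m).2 = (b m).2) ↔
      ((fun m => (a m).2) = fun m => (b m).2) ∧ c = fun m => ((a m).1, (b m).1) := by
    simp only [funext_iff, Prod.ext_iff, ← forall_and, Finset.mem_univ, forall_const]
    exact forall_congr' fun m => ⟨fun ⟨h1, h2, h3⟩ => ⟨h3, h1.symm, h2.symm⟩,
      fun ⟨h3, h1, h2⟩ => ⟨h1.symm, h2.symm, h3⟩⟩
  split_ifs with h1 h2 h2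
  · rfl
  · exact absurd (key.1 h1) h2
  · exact absurd (key.2 h2) h1
  · rfl

theorem splitFlattening_koszul_eprTriangle (p : ℕ) (v : K → (Fin k → Fin D) → ℂ)
    (a b : Fin k → Fin D × Fin D) (T : {T : Finset K // T.card = p + 1})
    (S : {S : Finset K // S.card = p}) :
    splitFlattening (I := fun _ => Fin k → Fin D × Fin D) (1 : Equiv.Perm (Fin 3)) (koszul p v)
      (tensorPow k (eprTriangle D)) (a, T) (b, S) =
      if (fun m => (a m).2) = (fun m => (b m).2) then
        ∑ κ, wedgeSign κ T S * (v κ (fun m => (a m).1) * v κ (fun m => (b m).1)) else 0 := by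
  have h : ∀ c, (Equiv.piCongrLeft (fun _ : Fin 3 => Fin k → Fin D × Fin D)
      (1 : Equiv.Perm (Fin 3)) (triple (K := fun _ => Fin k → Fin D × Fin D) a b c)) =
      triple a b c := fun c => by
    funext p
    exact Equiv.piCongrLeft_apply_apply _ (1 : Equiv.Perm (Fin 3)) _ p
  change ∑ κ, wedgeSign κ T S * ∑ c : Fin k → Fin D × Fin D,
    v κ (fun m => (c m).1) * v κ (fun m => (c m).2) *
    tensorPow k (eprTriangle D) (Equiv.piCongrLeft (fun _ : Fin 3 => Fin k → Fin D × Fin D)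
      (1 : Equiv.Perm (Fin 3)) (triple (K := fun _ => Fin k → Fin D × Fin D) a b c)) = _
  simp only [h, tensorPow_eprTriangle]
  split_ifs with hab <;> simp

/-- The matrix is injective. General position is used twice: `p + 1` of the vectors `v κ` are
independent, which separates the equations, and they span, which then forces the kernel vector to
vanish. -/
theorem rank_koszul_eprTriangle {p : ℕ} (hD : D ^ k = p + 1) (hK : Fintype.card K = 2 * p + 1)
    {v : K → (Fin k → Fin D) → ℂ}
    (hv : ∀ T : Finset K, T.card = Fintype.card (Fin k → Fin D) →
      (∀ c : K → ℂ, (∀ i, ∑ κ ∈ T, c κ * v κ i = 0) → ∀ κ ∈ T, c κ = 0) ∧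
      (∀ g : (Fin k → Fin D) → ℂ, (∀ κ ∈ T, ∑ i, v κ i * g i = 0) → g = 0)) :
    (splitFlattening (I := fun _ => Fin k → Fin D × Fin D) (1 : Equiv.Perm (Fin 3)) (koszul p v)
      (tensorPow k (eprTriangle D))).rank = (p + 1) ^ 2 * (2 * p + 1).choose p := by
  have hN : Fintype.card (Fin k → Fin D) = p + 1 := by simpa using hD
  have hcard : Fintype.card ((Fin k → Fin D × Fin D) × {S : Finset K // S.card = p}) =
      (p + 1) ^ 2 * (2 * p + 1).choose p := by
    rw [Fintype.card_prod, Fintype.card_finset_len, hK, ← hD]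
    simp [mul_pow, sq]
  rw [← hcard, ← Module.finrank_fintype_fun_eq_card ℂ]
  refine LinearMap.finrank_range_of_inj ((injective_iff_map_eq_zero _).2 fun g hg => ?_)
  -- `z i ρ` has first components `i` and second components `ρ`
  let z (i ρ : Fin k → Fin D) : Fin k → Fin D × Fin D := fun m => (i m, ρ m)
  let H (ρ : Fin k → Fin D) (κ : K) (S : {S : Finset K // S.card = p}) : ℂ :=
    ∑ j, v κ j * g (z j ρ, S)
  have hH : ∀ (i ρ : Fin k → Fin D) (T : {T : Finset K // T.card = p + 1}),
      ∑ κ, (∑ S, wedgeSign κ T S.1 * H ρ κ S) * v κ i = 0 := by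
    intro i ρ T
    have h := congrFun hg (z i ρ, T)
    have he : ∀ F : (Fin k → Fin D × Fin D) → ℂ, ∑ b, F b = ∑ σ', ∑ j, F (z j σ') := by
      intro F
      rw [← Equiv.sum_comp (Equiv.arrowProdEquivProdArrow (Fin k) (fun _ => Fin D)
        (fun _ => Fin D)).symm, Fintype.sum_prod_type, Finset.sum_comm]
      rfl
    simp only [Matrix.mulVecLin_apply, Matrix.mulVec, dotProduct, Fintype.sum_prod_type,
      splitFlattening_koszul_eprTriangle, he, Pi.zero_apply, z, ite_mul, zero_mul] at h
    rw [Finset.sum_eq_single_of_mem ρ (Finset.mem_univ _) fun σ' _ hσ =>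
      Finset.sum_eq_zero fun j _ => Finset.sum_eq_zero fun S _ => if_neg (Ne.symm hσ)] at h
    simp only [if_true] at h
    rw [← h]
    simp only [H, z, Finset.sum_mul, Finset.mul_sum]
    conv_lhs => rw [Finset.sum_comm]
    conv_rhs => rw [Finset.sum_comm]
    refine Finset.sum_congr rfl fun S _ => ?_
    rw [Finset.sum_comm]
    exact Finset.sum_congr rfl fun j _ => Finset.sum_congr rfl fun κ _ => by ring
  -- In the equation for `T = insert κ S` only the vectors indexed by `T` occur, and they are
  -- independent. The coefficient of `v κ` has the single term `S = T \ κ`, up to sign.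
  have hz : ∀ ρ S κ, κ ∉ S.1 → H ρ κ S = 0 := by
    intro ρ S κ hκ
    let T : {T : Finset K // T.card = p + 1} :=
      ⟨insert κ S.1, by rw [Finset.card_insert_of_notMem hκ, S.2]⟩
    have hsupp : ∀ κ', κ' ∉ T.1 → ∀ S' : Finset K, wedgeSign κ' T.1 S' = 0 := by
      intro κ' h S'
      refine if_neg fun h' => h ?_
      rw [← h'.2]
      exact Finset.mem_insert_self _ _
    have h := (hv T.1 (T.2.trans hN.symm)).1 (fun κ => ∑ S, wedgeSign κ T S.1 * H ρ κ S)
      (fun i => by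
        rw [← hH i ρ T]
        refine Finset.sum_subset (Finset.subset_univ _) fun κ' _ h => ?_
        rw [Finset.sum_eq_zero fun S' _ => by rw [hsupp κ' h, zero_mul], zero_mul])
      κ (Finset.mem_insert_self _ _)
    rw [Finset.sum_eq_single_of_mem S (Finset.mem_univ _) fun S' _ hS' => ?_] at h
    · refine (mul_eq_zero.1 h).resolve_left ?_
      rw [wedgeSign, if_pos ⟨hκ, rfl⟩]
      exact pow_ne_zero _ (by norm_num)
    · rw [wedgeSign, if_neg, zero_mul]
      rintro ⟨h1, h2⟩
      refine hS' (Subtype.ext ?_)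
      rw [← Finset.erase_insert h1, h2, Finset.erase_insert hκ]
  funext ⟨b, S⟩
  -- The choice `|K| = 2p + 1` makes the complement of a `p`-set have `p + 1` elements, just enough
  -- vectors `v κ` to span.
  have hS : S.1ᶜ.card = Fintype.card (Fin k → Fin D) := by
    rw [Finset.card_compl, S.2, hK, hN]
    omega
  have h := (hv S.1ᶜ hS).2 (fun j => g (z j (fun m => (b m).2), S)) fun κ hκ =>
    hz _ S κ (Finset.mem_compl.1 hκ)
  exact congrFun h (fun m => (b m).1)

/-- On a product tensor the flattening is an outer product of two vectors tensored with exterior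
multiplication by one `w`, and only the latter contributes to the rank. -/
theorem commRank_koszul_le {p : ℕ} (hK : Fintype.card K = 2 * p + 1)
    (v : K → (Fin k → Fin D) → ℂ) :
    commRank (splitFlattening (I := fun _ => Fin k → Fin D × Fin D) (1 : Equiv.Perm (Fin 3))
      (koszul p v)) ≤ (2 * p).choose p := by
  refine csSup_le' ?_
  rintro _ ⟨ψ, -, rfl⟩
  rw [splitFlattening_productTensor]
  refine (rank_tensor_le _ _ _).trans ((rank_wedge_le p _).trans ?_)
  rw [hK, Nat.add_sub_cancel]

/-- The lower bound on the level of GHZ states implied by the Koszul flattening of EPR pairs. -/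
theorem le_of_rank_splitFlattening_eprTriangle_le {s : ℕ}
    (h : ∀ (X Y : Type) [Fintype X] [Fintype Y]
      (P : ((Fin k → Fin D × Fin D) → ℂ) →ₗ[ℂ] Matrix X Y ℂ),
      (splitFlattening (I := fun _ => Fin k → Fin D × Fin D) (1 : Equiv.Perm (Fin 3)) P
        (tensorPow k (eprTriangle D))).rank ≤ s * commRank (splitFlattening
          (I := fun _ => Fin k → Fin D × Fin D) (1 : Equiv.Perm (Fin 3)) P)) :
    2 * ((D : ℤ) ^ k) ^ 2 - (D : ℤ) ^ k ≤ s := by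
  rcases Nat.eq_zero_or_pos (D ^ k) with h0 | hpos
  · have h0' : (D : ℤ) ^ k = 0 := by exact_mod_cast h0
    rw [h0']
    simp
  obtain ⟨p, hp⟩ := Nat.exists_eq_add_one.2 hpos
  obtain ⟨v, hv⟩ := exists_generalPosition (Fin (2 * p + 1)) (Fin k → Fin D)
  have h1 := h _ _ (koszul p v)
  rw [rank_koszul_eprTriangle hp (Fintype.card_fin _) hv] at h1
  have h2 := h1.trans (Nat.mul_le_mul_left s (commRank_koszul_le (Fintype.card_fin _) v))
  -- The quotient of the two binomial coefficients is (2p+1)/(p+1), which turns the rank bound into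
  -- `(p + 1) * (2 * p + 1) ≤ s`.
  have h3 : (2 * p + 1).choose p * (p + 1) = (2 * p + 1) * (2 * p).choose p := by
    rw [Nat.add_one_mul_choose_eq, ← Nat.choose_symm_half]
  have h4 : 0 < (2 * p).choose p := Nat.choose_pos (by omega)
  have h5 : (p + 1) * (2 * p + 1) ≤ s := by
    refine Nat.le_of_mul_le_mul_right ?_ h4
    calc (p + 1) * (2 * p + 1) * (2 * p).choose p
        = (p + 1) ^ 2 * (2 * p + 1).choose p := by rw [mul_assoc, ← h3]; ring
      _ ≤ _ := h2
  have h6 : (D : ℤ) ^ k = p + 1 := by exact_mod_cast hp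
  rw [h6]
  have h7 : ((p : ℤ) + 1) * (2 * p + 1) ≤ s := by exact_mod_cast h5
  linarith

end EPR

/-! ## Degrees in the kagome and triangular lattices -/

/-- One upward and one downward triangle. Hypergraph edges are counted, so the number does not
depend on the periods. -/
theorem kagome_degree (Λ : AddSubgroup (ℤ × ℤ)) (p : Fin 3) (v : ((ℤ × ℤ) ⧸ Λ) × Fin 3)
    (hv : v.2 = p) : Nat.card {e // (kagome Λ).vert e p = v} = 2 := by
  obtain ⟨x, q⟩ := v
  obtain rfl : q = p := hv
  let f : Bool ≃ {e // (kagome Λ).vert e q = (x, q)} :=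
    { toFun := fun b => match b with
        | true => ⟨(x, true), rfl⟩
        | false => ⟨(x + (kagomeShift q : (ℤ × ℤ) ⧸ Λ), false), by simp [kagome]⟩
      invFun := fun e => e.1.2
      left_inv := by rintro (_ | _) <;> rfl
      right_inv := by
        rintro ⟨⟨y, _ | _⟩, he⟩
        · have h : y - (kagomeShift q : (ℤ × ℤ) ⧸ Λ) = x := congrArg Prod.fst he
          simp [← h]
        · have h : y = x := congrArg Prod.fst he
          simp [h] }
  rw [← Nat.card_congr f]
  simp

/-- The colour of a vertex of the triangular lattice, as a party. -/
def triColourFin (Λ : AddSubgroup (ℤ × ℤ)) (hΛ : Λ ≤ triColour.ker) (v : (ℤ × ℤ) ⧸ Λ) : Fin 3 :=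
  (ZMod.finEquiv 3).symm (QuotientAddGroup.lift Λ triColour hΛ v)

theorem triColourFin_eq_iff (Λ : AddSubgroup (ℤ × ℤ)) (hΛ : Λ ≤ triColour.ker)
    (v : (ℤ × ℤ) ⧸ Λ) (p : Fin 3) :
    triColourFin Λ hΛ v = p ↔ QuotientAddGroup.lift Λ triColour hΛ v = ((p : ℕ) : ZMod 3) := by
  rw [triColourFin]
  generalize QuotientAddGroup.lift Λ triColour hΛ v = c
  revert c p
  decide

theorem triColourFin_vert (Λ : AddSubgroup (ℤ × ℤ)) (hΛ : Λ ≤ triColour.ker)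
    (e : ((ℤ × ℤ) ⧸ Λ) × Bool) (p : Fin 3) :
    triColourFin Λ hΛ ((triangular Λ hΛ).vert e p) = p := by
  rw [triColourFin_eq_iff]
  simp only [triangular, map_add, QuotientAddGroup.lift_mk, triColour_triOffset]
  ring

/-- The plaquettes at `v` are listed by orientation and by the colour of `v` relative to the base
point; subtracting the corresponding offset from `v` recovers the base point. -/
theorem triangular_degree (Λ : AddSubgroup (ℤ × ℤ)) (hΛ : Λ ≤ triColour.ker) (p : Fin 3)
    (v : (ℤ × ℤ) ⧸ Λ) (hv : triColourFin Λ hΛ v = p) :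
    Nat.card {e // (triangular Λ hΛ).vert e p = v} = 6 := by
  have hv' := (triColourFin_eq_iff Λ hΛ v p).1 hv
  have hc : ∀ b j, QuotientAddGroup.lift Λ triColour hΛ
      (v - ((triOffset b j : ℤ × ℤ) : (ℤ × ℤ) ⧸ Λ)) = ((p : ℕ) : ZMod 3) - j := fun b j => by
    rw [map_sub, hv', QuotientAddGroup.lift_mk, triColour_triOffset]
  let f : Bool × ZMod 3 ≃ {e // (triangular Λ hΛ).vert e p = v} :=
    { toFun := fun b => ⟨(v - ((triOffset b.1 b.2 : ℤ × ℤ) : (ℤ × ℤ) ⧸ Λ), b.1), by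
        simp only [triangular, hc, sub_sub_cancel, sub_add_cancel]⟩
      invFun := fun e =>
        (e.1.2, ((p : ℕ) : ZMod 3) - QuotientAddGroup.lift Λ triColour hΛ e.1.1)
      left_inv := fun b => by simp only [hc, sub_sub_cancel, Prod.mk.eta]
      right_inv := by
        rintro ⟨⟨y, b⟩, he⟩
        refine Subtype.ext (Prod.ext ?_ rfl)
        exact sub_eq_of_eq_add he.symm }
  rw [← Nat.card_congr f, Nat.card_prod, Nat.card_zmod]
  simp

/-! ### The flattening bounds on the two lattices -/

theorem kagome_flattening_bound {Λ : AddSubgroup (ℤ × ℤ)} [Fintype ((ℤ × ℤ) ⧸ Λ)] {r : ℕ}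
    {I : Fin 3 → Type*} [∀ p, Fintype (I p)] {φ : Tensor I}
    (h : Degenerates ((kagome Λ).state (ghz r)) ((kagome Λ).state φ))
    {X Y : Type*} [Fintype X] [Fintype Y] (σ : Equiv.Perm (Fin 3))
    (P : ((Fin 2 → I (σ 2)) → ℂ) →ₗ[ℂ] Matrix X Y ℂ) :
    (splitFlattening (I := fun p => Fin 2 → I p) σ P (tensorPow 2 φ)).rank ≤
      r ^ 2 * commRank (splitFlattening (I := fun p => Fin 2 → I p) σ P) := by
  classical
  have : Nonempty {v : ((ℤ × ℤ) ⧸ Λ) × Fin 3 // v.2 = σ 2} := ⟨⟨(0, σ 2), rfl⟩⟩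
  refine (kagome Λ).rank_splitFlattening_le_of_degenerates (col := Prod.snd) ?_ σ
    (kagome_degree Λ (σ 2)) P h
  rintro ⟨x, _ | _⟩ p <;> rfl

theorem triangular_flattening_bound {Λ : AddSubgroup (ℤ × ℤ)} [Fintype ((ℤ × ℤ) ⧸ Λ)]
    {hΛ : Λ ≤ triColour.ker} {r : ℕ} {I : Fin 3 → Type*} [∀ p, Fintype (I p)] {φ : Tensor I}
    (h : Degenerates ((triangular Λ hΛ).state (ghz r)) ((triangular Λ hΛ).state φ))
    {X Y : Type*} [Fintype X] [Fintype Y] (σ : Equiv.Perm (Fin 3))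
    (P : ((Fin 6 → I (σ 2)) → ℂ) →ₗ[ℂ] Matrix X Y ℂ) :
    (splitFlattening (I := fun p => Fin 6 → I p) σ P (tensorPow 6 φ)).rank ≤
      r ^ 6 * commRank (splitFlattening (I := fun p => Fin 6 → I p) σ P) := by
  classical
  have : Nonempty {v // triColourFin Λ hΛ v = σ 2} :=
    ⟨⟨_, triColourFin_vert Λ hΛ (0, true) (σ 2)⟩⟩
  exact (triangular Λ hΛ).rank_splitFlattening_le_of_degenerates (triColourFin_vert Λ hΛ) σ
    (triangular_degree Λ hΛ (σ 2)) P h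

end EntStruct

end

theorem mainTheorem4 :
    -- kagome lattice, arbitrary three-party state, arbitrary flattening map
    (∀ (Λ : AddSubgroup (ℤ × ℤ)) [Fintype ((ℤ × ℤ) ⧸ Λ)] (r : ℕ)
      (I : Fin 3 → Type*) [∀ p, Fintype (I p)] (φ : EntStruct.Tensor I),
      EntStruct.Degenerates ((EntStruct.kagome Λ).state (EntStruct.ghz r))
          ((EntStruct.kagome Λ).state φ) →
        ∀ (X Y : Type*) [Fintype X] [Fintype Y] (σ : Equiv.Perm (Fin 3))
          (P : ((Fin 2 → I (σ 2)) → ℂ) →ₗ[ℂ] Matrix X Y ℂ),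
          (EntStruct.splitFlattening (I := fun p => Fin 2 → I p) σ P
              (EntStruct.tensorPow 2 φ)).rank ≤
            r ^ 2 * EntStruct.commRank
              (EntStruct.splitFlattening (I := fun p => Fin 2 → I p) σ P)) ∧
    -- kagome lattice, EPR pairs on a triangle
    (∀ (Λ : AddSubgroup (ℤ × ℤ)) [Fintype ((ℤ × ℤ) ⧸ Λ)] (r D : ℕ),
      EntStruct.Degenerates ((EntStruct.kagome Λ).state (EntStruct.ghz r))
          ((EntStruct.kagome Λ).state (EntStruct.eprTriangle D)) →
        2 * (D : ℤ) ^ 4 - (D : ℤ) ^ 2 ≤ (r : ℤ) ^ 2) ∧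
    -- triangular lattice, arbitrary three-party state, arbitrary flattening map
    (∀ (Λ : AddSubgroup (ℤ × ℤ)) [Fintype ((ℤ × ℤ) ⧸ Λ)] (hΛ : Λ ≤ EntStruct.triColour.ker) (r : ℕ)
      (I : Fin 3 → Type*) [∀ p, Fintype (I p)] (φ : EntStruct.Tensor I),
      EntStruct.Degenerates ((EntStruct.triangular Λ hΛ).state (EntStruct.ghz r))
          ((EntStruct.triangular Λ hΛ).state φ) →
        ∀ (X Y : Type*) [Fintype X] [Fintype Y] (σ : Equiv.Perm (Fin 3))
          (P : ((Fin 6 → I (σ 2)) → ℂ) →ₗ[ℂ] Matrix X Y ℂ),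
          (EntStruct.splitFlattening (I := fun p => Fin 6 → I p) σ P
              (EntStruct.tensorPow 6 φ)).rank ≤
            r ^ 6 * EntStruct.commRank
              (EntStruct.splitFlattening (I := fun p => Fin 6 → I p) σ P)) ∧
    -- triangular lattice, EPR pairs on a triangle
    (∀ (Λ : AddSubgroup (ℤ × ℤ)) [Fintype ((ℤ × ℤ) ⧸ Λ)] (hΛ : Λ ≤ EntStruct.triColour.ker)
      (r D : ℕ),
      EntStruct.Degenerates ((EntStruct.triangular Λ hΛ).state (EntStruct.ghz r))
          ((EntStruct.triangular Λ hΛ).state (EntStruct.eprTriangle D)) →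
        2 * (D : ℤ) ^ 12 - (D : ℤ) ^ 6 ≤ (r : ℤ) ^ 6) := by
  refine ⟨fun Λ _ r I _ φ h X Y _ _ σ P => EntStruct.kagome_flattening_bound h σ P,
    fun Λ _ r D h => ?_,
    fun Λ _ hΛ r I _ φ h X Y _ _ σ P => EntStruct.triangular_flattening_bound h σ P,
    fun Λ _ hΛ r D h => ?_⟩
  · have h1 := EntStruct.le_of_rank_splitFlattening_eprTriangle_le (k := 2) (D := D) (s := r ^ 2)
      fun X Y _ _ P => EntStruct.kagome_flattening_bound h 1 P
    push_cast at h1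
    linarith [pow_mul (D : ℤ) 2 2]
  · have h1 := EntStruct.le_of_rank_splitFlattening_eprTriangle_le (k := 6) (D := D) (s := r ^ 6)
      fun X Y _ _ P => EntStruct.triangular_flattening_bound h 1 P
    push_cast at h1
    linarith [pow_mul (D : ℤ) 6 2]
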